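/- Let $n\ge 0$. Every Boolean function $f:\mathbb{Z}_2^n\to\mathbb{Z}_2$ is uniquely a sum of monomials $\prod_{i\in S}x_i$, $S\subseteq\{0,\dots,n-1\}$ (its algebraic normal form). Call $f$ *quadratic* if all monomials that occur have degree at most $2$; its graph is then the simple graph on $\{0,\dots,n-1\}$ in which $i\neq j$ are adjacent if and only if $x_ix_j$ occurs (linear and constant terms are ignored). For a simple graph $G$ on $\{0,\dots,n-1\}$ and a vertex $v$, local complementation at $v$ replaces the subgraph induced on the neighbourhood of $v$ by its complement and leaves all other adjacencies unchanged. The LC orbit $[G]$ is the set of all graphs on $\{0,\dots,n-1\}$ obtained from $G$ by finite sequences of local complementations and vertex permutations. Let $\alpha(K)$ be the largest size of an independent set of $K$, and let $\lambda(G)=\max_{K\in[G]}\alpha(K)$. Let $$I=\begin{pmatrix}1&0\\0&1\end{pmatrix},\quad H=\tfrac1{\sqrt2}\begin{pmatrix}1&1\\1&-1\end{pmatrix},\quad N=\tfrac1{\sqrt2}\begin{pmatrix}1&i\\1&-i\end{pmatrix},$$ and for a Boolean function $f$ of $n$ variables put $s=2^{-n/2}\bigl((-1)^{f(x)}\bigr)_{x\in\mathbb{Z}_2^n}$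 and $$\mathrm{PAR}_{IHN}(f)=2^n\max_{U,\,k}\bigl|(Us)_k\bigr|^2,$$ where $U$ runs over all $3^n$ tensor products $U_0\otimes\cdots\otimes U_{n-1}$ with $U_i\in\{I,H,N\}$, and $k$ over $\mathbb{Z}_2^n$. **Theorem.** Let $G$ be a simple graph on $\{0,\dots,n-1\}$. Then every quadratic Boolean function $f$ of $n$ variables whose graph lies in the LC orbit $[G]$ satisfies $\mathrm{PAR}_{IHN}(f)=2^{\lambda(G)}$. -/

import Mathlib

namespace BoolPAR

/-! ### Boolean functions, algebraic normal form, and the associated graph -/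

/-- The vector in `ℤ₂ⁿ` with support `T`. -/
def indVec {n : ℕ} (T : Finset (Fin n)) : Fin n → ZMod 2 :=
  fun i => if i ∈ T then 1 else 0

/-- The coefficient of the monomial `∏ i ∈ S, x i` in the algebraic normal form of `f`, obtained
from the truth table of `f` by the binary Möbius transform (see `eq_sum_anfCoeff`). -/
def anfCoeff {n : ℕ} (f : (Fin n → ZMod 2) → ZMod 2) (S : Finset (Fin n)) : ZMod 2 :=
  ∑ T ∈ S.powerset, f (indVec T)

theorem eq_sum_anfCoeff {n : ℕ} (f : (Fin n → ZMod 2) → ZMod 2) (x : Fin n → ZMod 2) :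
    f x = ∑ S : Finset (Fin n), anfCoeff f S * ∏ i ∈ S, x i := by
  obtain ⟨X, rfl⟩ : ∃ X : Finset (Fin n), x = indVec X := by
    refine ⟨Finset.univ.filter fun i => x i = 1, ?_⟩
    funext i
    have h : ∀ a : ZMod 2, a = if a = 1 then 1 else 0 := by decide
    simpa [indVec] using h (x i)
  have h1 : ∀ S : Finset (Fin n), ∏ i ∈ S, indVec X i = if S ⊆ X then 1 else 0 := by
    intro S
    split_ifs with h
    · exact Finset.prod_eq_one fun i hi => by simp [indVec, h hi]
    · obtain ⟨i, hi, hiX⟩ := Finset.not_subset.1 h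
      exact Finset.prod_eq_zero hi (by simp [indVec, hiX])
  have h2 : ∀ T : Finset (Fin n), T ∈ (Finset.univ : Finset (Finset (Fin n))) →
      (∑ S : Finset (Fin n), if T ⊆ S ∧ S ⊆ X then f (indVec T) else 0) =
        if T = X then f (indVec T) else 0 := by
    intro T _
    rw [← Finset.sum_filter]
    have h3 : (Finset.univ.filter fun S : Finset (Fin n) => T ⊆ S ∧ S ⊆ X) = Finset.Icc T X := by
      ext S; simp
    rw [h3, Finset.sum_const]
    by_cases hTX : T ⊆ X
    · rw [Finset.card_Icc_finset hTX]
      by_cases h : T = X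
      · simp [h]
      · have hlt : T.card < X.card :=
          Finset.card_lt_card (Finset.ssubset_iff_subset_ne.2 ⟨hTX, h⟩)
        obtain ⟨k, hk⟩ : ∃ k, X.card - T.card = k + 1 := ⟨X.card - T.card - 1, by omega⟩
        have h20 : (2 : ZMod 2) = 0 := by decide
        simp [h, hk, pow_succ, h20]
    · have h : T ≠ X := fun h => hTX h.subset
      simp [h, Finset.Icc_eq_empty (a := T) (b := X) hTX]
  calc f (indVec X) = ∑ T : Finset (Fin n), if T = X then f (indVec T) else 0 := by simp
    _ = ∑ T : Finset (Fin n), ∑ S : Finset (Fin n),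
          if T ⊆ S ∧ S ⊆ X then f (indVec T) else 0 := (Finset.sum_congr rfl h2).symm
    _ = ∑ S : Finset (Fin n), anfCoeff f S * ∏ i ∈ S, indVec X i := by
        rw [Finset.sum_comm]
        refine Finset.sum_congr rfl fun S _ => ?_
        rw [h1, anfCoeff, mul_ite, mul_one, mul_zero]
        by_cases hS : S ⊆ X
        · simp only [hS, and_true, if_true]
          rw [← Finset.sum_filter]
          refine Finset.sum_congr ?_ fun _ _ => rfl
          ext T; simp
        · simp [hS]

/-- A Boolean function is quadratic if its algebraic normal form has no monomial of degree
greater than two. -/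
def IsQuadratic {n : ℕ} (f : (Fin n → ZMod 2) → ZMod 2) : Prop :=
  ∀ S : Finset (Fin n), 2 < S.card → anfCoeff f S = 0

/-- The simple graph of a quadratic Boolean function: `i` and `j` are adjacent iff the monomial
`x i * x j` occurs in the algebraic normal form. Linear and constant terms are ignored. -/
def graphOf {n : ℕ} (f : (Fin n → ZMod 2) → ZMod 2) : SimpleGraph (Fin n) where
  Adj i j := i ≠ j ∧ anfCoeff f {i, j} ≠ 0
  symm := ⟨fun i j h => ⟨h.1.symm, by rw [Finset.pair_comm]; exact h.2⟩⟩
  loopless := ⟨fun _ h => h.1 rfl⟩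

/-! ### Local complementation and the LC orbit -/

/-- Local complementation at `v`: the subgraph induced on the neighbourhood of `v` is replaced by
its complement, all other adjacencies are kept. -/
def localComp {V : Type*} (G : SimpleGraph V) (v : V) : SimpleGraph V where
  Adj i j := i ≠ j ∧ Xor (G.Adj i j) (G.Adj v i ∧ G.Adj v j)
  symm := ⟨fun i j h => ⟨h.1.symm, by rw [G.adj_comm j i, and_comm]; exact h.2⟩⟩
  loopless := ⟨fun _ h => h.1 rfl⟩

/-- One step: a local complementation or a permutation of the vertices. -/
def LCStep {V : Type*} (G K : SimpleGraph V) : Prop :=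
  (∃ v, K = localComp G v) ∨ ∃ π : Equiv.Perm V, K = G.map π.toEmbedding

/-- The LC orbit `[G]`: all graphs obtained from `G` by a finite sequence of local
complementations and vertex permutations. -/
def lcOrbit {V : Type*} (G : SimpleGraph V) : Set (SimpleGraph V) :=
  {K | Relation.ReflTransGen LCStep G K}

/-- `λ(G)`: the largest independence number of a graph in the LC orbit of `G`. -/
noncomputable def lam {n : ℕ} (G : SimpleGraph (Fin n)) : ℕ :=
  sSup {a | ∃ K ∈ lcOrbit G, a = K.indepNum}

/-! ### Transforms and the peak-to-average power ratio -/

/-- The Hadamard matrix. -/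
noncomputable def hadamard : Matrix (ZMod 2) (ZMod 2) ℂ :=
  ((Real.sqrt 2 : ℝ) : ℂ)⁻¹ • (!![1, 1; 1, -1] : Matrix (Fin 2) (Fin 2) ℂ)

/-- The negahadamard matrix. -/
noncomputable def negahadamard : Matrix (ZMod 2) (ZMod 2) ℂ :=
  ((Real.sqrt 2 : ℝ) : ℂ)⁻¹ • (!![1, Complex.I; 1, -Complex.I] : Matrix (Fin 2) (Fin 2) ℂ)

/-- The transform set `{I, H, N}`. -/
noncomputable def transIHN : Fin 3 → Matrix (ZMod 2) (ZMod 2) ℂ :=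
  ![1, hadamard, negahadamard]

/-- The tensor product `U 0 ⊗ ⋯ ⊗ U (n-1)`, acting on vectors indexed by `ℤ₂ⁿ`. -/
def tensor {n : ℕ} (U : Fin n → Matrix (ZMod 2) (ZMod 2) ℂ) :
    Matrix (Fin n → ZMod 2) (Fin n → ZMod 2) ℂ :=
  Matrix.of fun k x => ∏ i, U i (k i) (x i)

/-- The peak-to-average power ratio of the vector `s` of length `2ⁿ` with respect to the transform
set `{T j | j ∈ ι}ⁿ`. -/
noncomputable def PAR {ι : Type*} [Fintype ι] [Nonempty ι] {n : ℕ}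
    (T : ι → Matrix (ZMod 2) (ZMod 2) ℂ) (s : (Fin n → ZMod 2) → ℂ) : ℝ :=
  2 ^ n * (Finset.univ : Finset ((Fin n → ι) × (Fin n → ZMod 2))).sup' Finset.univ_nonempty
    fun p => ‖(tensor (fun i => T (p.1 i))).mulVec s p.2‖ ^ 2

/-- The normalised bipolar vector `s = 2^{-n/2} (-1)^{f(x)}` of a Boolean function `f`. -/
noncomputable def stateVec {n : ℕ} (f : (Fin n → ZMod 2) → ZMod 2) : (Fin n → ZMod 2) → ℂ :=
  fun x => (((Real.sqrt 2 : ℝ) : ℂ) ^ n)⁻¹ * (-1) ^ (f x).val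

/-- The `PAR` of a Boolean function with respect to the `{I, H, N}ⁿ` transform. -/
noncomputable def parIHN {n : ℕ} (f : (Fin n → ZMod 2) → ZMod 2) : ℝ :=
  PAR transIHN (stateVec f)

end BoolPAR

/-!
The outputs of all `{I, H, N}` transforms of a quadratic `f` are, up to phases and powers of `√2`,
exactly the sums `∑ i ^ q(x)` over the `x` supported in some set `R` of coordinates, where `q` is a
quadratic form over `ℤ₄` whose off-diagonal part is the graph of `f`: the set `R` collects the
positions of `H` and `N`, and these choices together with the output index allow every diagonal `d`.

Summing out a coordinate `v` with `d v` odd is a Gauss sum that replaces the graph by its local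
complement at `v` and removes `v` from `R`; for `d v` even, completing the square gives the local
complement without removing `v`. Hence the set of normalised powers of these sums is the same for
all graphs in an LC orbit. As long as `R` contains an edge, one of its coordinates can be summed
out, so every power is at most `2 ^ |R|` for a set `R` independent in some graph of the orbit.
Conversely, an independent set with zero diagonal attains this value.
-/

namespace BoolPAR

open Finset

lemma addChar_sum {A M ι : Type*} [AddCommMonoid A] [CommMonoid M] (ψ : AddChar A M)
    (s : Finset ι) (c : ι → A) : ψ (∑ i ∈ s, c i) = ∏ i ∈ s, ψ (c i) :=
  map_prod ψ.toMonoidHom (fun i => Multiplicative.ofAdd (c i)) s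

/-- The additive character `a ↦ i ^ a` of `ℤ₄`. -/
noncomputable def iPow : AddChar (ZMod 4) ℂ :=
  AddChar.zmodChar 4 Complex.I_pow_four

lemma iPow_one : iPow 1 = Complex.I := by
  simp [iPow, AddChar.zmodChar_apply, show (1 : ZMod 4).val = 1 from rfl]

lemma iPow_two : iPow 2 = -1 := by
  simp [iPow, AddChar.zmodChar_apply, show (2 : ZMod 4).val = 2 from rfl]

lemma iPow_three : iPow 3 = -Complex.I := by
  simp [iPow, AddChar.zmodChar_apply, show (3 : ZMod 4).val = 3 from rfl]

lemma even_or_odd_zmod_four (c : ZMod 4) : Even c ∨ Odd c := by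
  unfold Even Odd
  revert c
  decide

lemma eq_one_or_eq_three_of_odd {c : ZMod 4} (hc : Odd c) : c = 1 ∨ c = 3 := by
  obtain ⟨m, rfl⟩ := hc
  revert m
  decide

lemma normSq_one_add_iPow_of_odd {c : ZMod 4} (hc : Odd c) : ‖1 + iPow c‖ ^ 2 = 2 := by
  rw [← Complex.normSq_eq_norm_sq]
  rcases eq_one_or_eq_three_of_odd hc with rfl | rfl
  · norm_num [iPow_one, Complex.normSq_apply]
  · norm_num [iPow_three, Complex.normSq_apply]

lemma one_add_iPow_of_odd {c : ZMod 4} (hc : Odd c) (w : ZMod 4) :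
    1 + iPow (2 * w + c) = (1 + iPow c) * iPow (-c * w ^ 2) := by
  have parity : (2 * w + c = c ∧ -c * w ^ 2 = 0) ∨ (2 * w + c = -c ∧ -c * w ^ 2 = -c) := by
    obtain ⟨m, rfl⟩ := hc
    revert m w
    decide
  rcases parity with ⟨h, h'⟩ | ⟨h, h'⟩
  · rw [h, h', AddChar.map_zero_eq_one, mul_one]
  · rw [h, h', add_mul, one_mul, ← iPow.map_add_eq_mul, add_neg_cancel, AddChar.map_zero_eq_one,
      add_comm]

lemma one_add_iPow_mul_iPow_sq (r w : ZMod 4) :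
    (1 + iPow (2 * w + (r + r))) * iPow (w ^ 2) =
      (1 + iPow (2 * w + (r + r))) * iPow (r ^ 2) := by
  have parity : 2 * w + (r + r) = 2 ∨ w ^ 2 = r ^ 2 := by
    revert r w
    decide
  rcases parity with h | h
  · rw [h, iPow_two, add_neg_cancel, zero_mul, zero_mul]
  · rw [h]

/-! ### Quadratic forms over `ℤ₄` attached to a graph -/

section GraphForm

variable {V W : Type*}

open scoped Classical in
/-- The adjacency matrix of `G` over `ℤ₄`. Decidability of adjacency is classical, so that the
matrix of a local complement needs no further instances. -/
noncomputable def adjZMod4 (G : SimpleGraph V) (i j : V) : ZMod 4 :=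
  if G.Adj i j then 1 else 0

/-- The quadratic form `∑ i, d i * x i + 2 * ∑ {i, j} ∈ E(G), x i * x j` over `ℤ₄`, evaluated at
the indicator vector of `T`. The sum over ordered pairs meets every edge twice, which accounts for
the factor `2`. -/
noncomputable def graphForm (G : SimpleGraph V) (d : V → ZMod 4) (T : Finset V) : ZMod 4 :=
  ∑ i ∈ T, d i + ∑ i ∈ T, ∑ j ∈ T, adjZMod4 G i j

lemma adjZMod4_congr {G : SimpleGraph V} {K : SimpleGraph W} {i j : V} {k l : W}
    (h : G.Adj i j ↔ K.Adj k l) : adjZMod4 G i j = adjZMod4 K k l := by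
  by_cases hK : K.Adj k l <;> simp [adjZMod4, h, hK]

lemma adjZMod4_comm (G : SimpleGraph V) (i j : V) : adjZMod4 G i j = adjZMod4 G j i :=
  adjZMod4_congr (G.adj_comm i j)

lemma adjZMod4_self (G : SimpleGraph V) (i : V) : adjZMod4 G i i = 0 :=
  if_neg G.irrefl

lemma localComp_adj {G : SimpleGraph V} {v i j : V} :
    (localComp G v).Adj i j ↔ i ≠ j ∧ Xor (G.Adj i j) (G.Adj v i ∧ G.Adj v j) :=
  Iff.rfl

lemma localComp_adj_self_left (G : SimpleGraph V) (v j : V) :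
    (localComp G v).Adj v j ↔ G.Adj v j := by
  simpa [localComp_adj, Xor] using G.ne_of_adj

lemma localComp_localComp (G : SimpleGraph V) (v : V) : localComp (localComp G v) v = G := by
  ext i j
  have hne : G.Adj i j → i ≠ j := G.ne_of_adj
  rw [localComp_adj, localComp_adj_self_left, localComp_adj_self_left, localComp_adj]
  unfold Xor
  tauto

lemma adjZMod4_localComp_self (G : SimpleGraph V) (v : V) :
    adjZMod4 (localComp G v) v = adjZMod4 G v := by
  ext j
  exact adjZMod4_congr (localComp_adj_self_left G v j)

/-- The exclusive or of two bits is `a + b - 2ab`, hence additive after doubling in `ℤ₄`. -/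
lemma two_mul_adjZMod4_localComp (G : SimpleGraph V) (v : V) {i j : V} (hij : i ≠ j) :
    2 * adjZMod4 (localComp G v) i j =
      2 * adjZMod4 G i j + 2 * (adjZMod4 G v i * adjZMod4 G v j) := by
  have two_add_two : (2 : ZMod 4) + 2 = 0 := by decide
  by_cases h : G.Adj i j <;> by_cases hi : G.Adj v i <;> by_cases hj : G.Adj v j <;>
    simp [adjZMod4, localComp_adj, Xor, h, hi, hj, hij, two_add_two]

lemma graphForm_add (G : SimpleGraph V) (d e : V → ZMod 4) (T : Finset V) :
    graphForm G (d + e) T = graphForm G d T + ∑ i ∈ T, e i := by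
  simp only [graphForm, Pi.add_apply, sum_add_distrib]
  ring

lemma graphForm_union [DecidableEq V] (G : SimpleGraph V) (d : V → ZMod 4) {S T : Finset V}
    (hST : Disjoint S T) :
    graphForm G d (S ∪ T) =
      graphForm G (d + fun i => 2 * ∑ j ∈ T, adjZMod4 G i j) S + graphForm G d T := by
  have hswap : ∑ i ∈ T, ∑ j ∈ S, adjZMod4 G i j = ∑ i ∈ S, ∑ j ∈ T, adjZMod4 G i j := by
    simp only [sum_comm (s := T), adjZMod4_comm G]
  rw [graphForm_add, ← mul_sum]
  simp only [graphForm, sum_union hST, sum_add_distrib, hswap]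
  ring

lemma graphForm_insert [DecidableEq V] (G : SimpleGraph V) (d : V → ZMod 4) {v : V}
    {T : Finset V} (hv : v ∉ T) :
    graphForm G d (insert v T) = graphForm G d T + (2 * ∑ j ∈ T, adjZMod4 G v j + d v) := by
  rw [insert_eq, graphForm_union G d (disjoint_singleton_left.2 hv)]
  simp only [graphForm, sum_singleton, Pi.add_apply, adjZMod4_self]
  ring

lemma graphForm_localComp (G : SimpleGraph V) (d : V → ZMod 4) (v : V) {t : ZMod 4} (ht : Odd t)
    (T : Finset V) :
    graphForm (localComp G v) (d + t • adjZMod4 G v) T =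
      graphForm G d T + t * (∑ j ∈ T, adjZMod4 G v j) ^ 2 := by
  classical
  have two_mul_odd : t * 2 = 2 := by
    rcases eq_one_or_eq_three_of_odd ht with rfl | rfl <;> decide
  induction T using Finset.induction_on with
  | empty => simp [graphForm]
  | insert u T hu ih =>
    have hrow : 2 * ∑ j ∈ T, adjZMod4 (localComp G v) u j =
        2 * ∑ j ∈ T, adjZMod4 G u j + t * 2 * (adjZMod4 G v u * ∑ j ∈ T, adjZMod4 G v j) := by
      rw [two_mul_odd]
      simp only [mul_sum, ← sum_add_distrib]
      exact sum_congr rfl fun j hj =>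
        two_mul_adjZMod4_localComp G v (ne_of_mem_of_not_mem hj hu).symm
    have hsq : adjZMod4 G v u ^ 2 = adjZMod4 G v u := by
      by_cases h : G.Adj v u <;> simp [adjZMod4, h]
    rw [graphForm_insert _ _ hu, graphForm_insert _ _ hu, ih, hrow, sum_insert hu, Pi.add_apply,
      Pi.smul_apply, smul_eq_mul]
    linear_combination -t * hsq

end GraphForm

/-! ### Exponential sums of graphs -/

section Power

variable {V W : Type*}

/-- The exponential sum `∑ i ^ q(x)` of `q = graphForm G d` over the `0/1`-vectors `x` supported
in `R`. -/
noncomputable def expSum (G : SimpleGraph V) (d : V → ZMod 4) (R : Finset V) : ℂ :=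
  ∑ T ∈ R.powerset, iPow (graphForm G d T)

/-- The normalised power `|expSum G d R|² / 2 ^ |R|`. -/
noncomputable def power (G : SimpleGraph V) (d : V → ZMod 4) (R : Finset V) : ℝ :=
  ‖expSum G d R‖ ^ 2 / 2 ^ #R

/-- All normalised powers of exponential sums of `G`. For the graph of a quadratic Boolean function
these are the spectral powers over all `{I, H, N}` transforms. -/
def powerSpectrum (G : SimpleGraph V) : Set ℝ :=
  {r | ∃ d R, power G d R = r}

lemma power_le (G : SimpleGraph V) (d : V → ZMod 4) (R : Finset V) : power G d R ≤ 2 ^ #R := by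
  have hnorm : ‖expSum G d R‖ ≤ 2 ^ #R := by
    refine (norm_sum_le _ _).trans ?_
    simp [card_powerset]
  rw [power, div_le_iff₀ (by positivity), ← sq]
  exact pow_le_pow_left₀ (norm_nonneg _) hnorm 2

lemma power_congr (G : SimpleGraph V) {d e : V → ZMod 4} {R : Finset V}
    (h : ∀ i ∈ R, d i = e i) : power G d R = power G e R := by
  have hform : ∀ T ∈ R.powerset, graphForm G d T = graphForm G e T := fun T hT => by
    rw [graphForm, graphForm, sum_congr rfl fun i hi => h i (mem_powerset.1 hT hi)]
  rw [power, power, expSum, expSum, sum_congr rfl fun T hT => by rw [hform T hT]]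

lemma power_zero_of_isIndepSet {G : SimpleGraph V} {R : Finset V} (h : G.IsIndepSet R) :
    power G 0 R = 2 ^ #R := by
  have hform : ∀ T ∈ R.powerset, graphForm G 0 T = 0 := fun T hT => by
    have hT := mem_powerset.1 hT
    rw [graphForm, sum_eq_zero fun _ _ => Pi.zero_apply _, zero_add]
    refine sum_eq_zero fun i hi => sum_eq_zero fun j hj => if_neg fun hij => ?_
    exact h (hT hi) (hT hj) hij.ne hij
  rw [power, expSum, sum_congr rfl fun T hT => by rw [hform T hT]]
  simp [card_powerset, sq]

lemma expSum_insert [DecidableEq V] (G : SimpleGraph V) (d : V → ZMod 4) {v : V} {R : Finset V}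
    (hv : v ∉ R) :
    expSum G d (insert v R) = ∑ T ∈ R.powerset,
      (1 + iPow (2 * ∑ j ∈ T, adjZMod4 G v j + d v)) * iPow (graphForm G d T) := by
  rw [expSum, sum_powerset_insert hv, ← sum_add_distrib]
  refine sum_congr rfl fun T hT => ?_
  rw [graphForm_insert G d fun h => hv (mem_powerset.1 hT h), iPow.map_add_eq_mul]
  ring

/-- Summing out the coordinate `v` leaves a sum of the same kind, by the Gauss sum identity
`one_add_iPow_of_odd`. -/
theorem power_insert_of_odd [DecidableEq V] (G : SimpleGraph V) {d : V → ZMod 4} {v : V}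
    {R : Finset V} (hv : v ∉ R) (hd : Odd (d v)) :
    power G d (insert v R) = power (localComp G v) (d + -d v • adjZMod4 G v) R := by
  have hsum : expSum G d (insert v R) =
      (1 + iPow (d v)) * expSum (localComp G v) (d + -d v • adjZMod4 G v) R := by
    rw [expSum_insert G d hv, expSum, mul_sum]
    refine sum_congr rfl fun T _ => ?_
    rw [one_add_iPow_of_odd hd, graphForm_localComp G d v hd.neg, iPow.map_add_eq_mul]
    ring
  rw [power, power, hsum, norm_mul, mul_pow, normSq_one_add_iPow_of_odd hd,
    card_insert_of_notMem hv, pow_succ' (2 : ℝ), mul_div_mul_left _ _ two_ne_zero]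

theorem power_insert_of_even [DecidableEq V] (G : SimpleGraph V) {d : V → ZMod 4} {v : V}
    {R : Finset V} (hv : v ∉ R) (hd : Even (d v)) :
    power G d (insert v R) = power (localComp G v) (d + adjZMod4 G v) (insert v R) := by
  obtain ⟨r, hr⟩ := hd
  have hdv : (d + adjZMod4 G v) v = r + r := by simp [hr, adjZMod4_self]
  have hform (T : Finset V) : graphForm (localComp G v) (d + adjZMod4 G v) T =
      graphForm G d T + (∑ j ∈ T, adjZMod4 G v j) ^ 2 := by
    simpa using graphForm_localComp G d v odd_one T
  have hsum : expSum (localComp G v) (d + adjZMod4 G v) (insert v R) =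
      iPow (r ^ 2) * expSum G d (insert v R) := by
    rw [expSum_insert _ _ hv, expSum_insert _ _ hv, mul_sum, adjZMod4_localComp_self, hdv, hr]
    refine sum_congr rfl fun T _ => ?_
    rw [hform, iPow.map_add_eq_mul (graphForm G d T)]
    linear_combination
      iPow (graphForm G d T) * one_add_iPow_mul_iPow_sq r (∑ j ∈ T, adjZMod4 G v j)
  rw [power, power, hsum, norm_mul, AddChar.norm_apply, one_mul]

/-! ### Invariance of the power spectrum on the LC orbit -/

theorem powerSpectrum_subset_localComp (G : SimpleGraph V) (v : V) :
    powerSpectrum G ⊆ powerSpectrum (localComp G v) := by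
  classical
  rintro _ ⟨d, R, rfl⟩
  by_cases hv : v ∈ R
  · rw [← insert_erase hv]
    rcases even_or_odd_zmod_four (d v) with hd | hd
    · exact ⟨_, _, (power_insert_of_even G (notMem_erase v R) hd).symm⟩
    · exact ⟨_, _, (power_insert_of_odd G (notMem_erase v R) hd).symm⟩
  · -- Summing out `v` with diagonal entry `1` undoes the local complementation.
    refine ⟨Function.update (d + adjZMod4 G v) v 1, insert v R, ?_⟩
    rw [power_insert_of_odd _ hv (by simp), localComp_localComp, adjZMod4_localComp_self]
    refine power_congr G fun i hi => ?_
    simp [Function.update_of_ne (ne_of_mem_of_not_mem hi hv)]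

theorem powerSpectrum_localComp (G : SimpleGraph V) (v : V) :
    powerSpectrum (localComp G v) = powerSpectrum G := by
  refine subset_antisymm ?_ (powerSpectrum_subset_localComp G v)
  simpa only [localComp_localComp] using powerSpectrum_subset_localComp (localComp G v) v

lemma graphForm_map_iso {G : SimpleGraph V} {K : SimpleGraph W} (φ : G ≃g K) (d : V → ZMod 4)
    (T : Finset V) :
    graphForm K (d ∘ φ.symm) (T.map φ.toEquiv.toEmbedding) = graphForm G d T := by
  simp [graphForm, adjZMod4_congr φ.map_adj_iff]

lemma power_map_iso {G : SimpleGraph V} {K : SimpleGraph W} (φ : G ≃g K) (d : V → ZMod 4)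
    (R : Finset V) :
    power K (d ∘ φ.symm) (R.map φ.toEquiv.toEmbedding) = power G d R := by
  have hsum : expSum K (d ∘ φ.symm) (R.map φ.toEquiv.toEmbedding) = expSum G d R := by
    refine (sum_equiv φ.toEquiv.finsetCongr (fun T => by simp) fun T _ => ?_).symm
    rw [Equiv.finsetCongr_apply, graphForm_map_iso]
  rw [power, power, hsum, card_map]

theorem powerSpectrum_subset_of_iso {G : SimpleGraph V} {K : SimpleGraph W} (φ : G ≃g K) :
    powerSpectrum G ⊆ powerSpectrum K := by
  rintro _ ⟨d, R, rfl⟩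
  exact ⟨_, _, power_map_iso φ d R⟩

theorem powerSpectrum_congr {G : SimpleGraph V} {K : SimpleGraph W} (φ : G ≃g K) :
    powerSpectrum G = powerSpectrum K :=
  subset_antisymm (powerSpectrum_subset_of_iso φ) (powerSpectrum_subset_of_iso φ.symm)

theorem powerSpectrum_eq_of_mem_lcOrbit {G K : SimpleGraph V} (h : K ∈ lcOrbit G) :
    powerSpectrum K = powerSpectrum G := by
  induction (show Relation.ReflTransGen LCStep G K from h) with
  | refl => rfl
  | tail hGK hstep ih =>
    rw [← ih hGK]
    rcases hstep with ⟨v, rfl⟩ | ⟨π, rfl⟩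
    · exact powerSpectrum_localComp _ v
    · exact (powerSpectrum_congr (SimpleGraph.Iso.map π _)).symm

/-! ### The largest power and independent sets -/

lemma mem_lcOrbit_self (G : SimpleGraph V) : G ∈ lcOrbit G :=
  Relation.ReflTransGen.refl

lemma localComp_mem_lcOrbit (G : SimpleGraph V) (v : V) : localComp G v ∈ lcOrbit G :=
  Relation.ReflTransGen.single (Or.inl ⟨v, rfl⟩)

lemma lcOrbit_trans {G K L : SimpleGraph V} (hK : K ∈ lcOrbit G) (hL : L ∈ lcOrbit K) :
    L ∈ lcOrbit G :=
  Relation.ReflTransGen.trans hK hL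

lemma exists_odd_of_not_isIndepSet {G : SimpleGraph V} {R : Finset V} (hR : ¬ G.IsIndepSet R)
    (d : V → ZMod 4) :
    ∃ K ∈ lcOrbit G, ∃ e : V → ZMod 4, ∃ v ∈ R, Odd (e v) ∧ power G d R = power K e R := by
  classical
  obtain ⟨v, hv, w, hw, hvw⟩ : ∃ v ∈ R, ∃ w ∈ R, G.Adj v w := by
    by_contra! hcon
    exact hR fun v hv w hw _ => hcon v hv w hw
  rcases even_or_odd_zmod_four (d v) with hdv | hdv
  · rcases even_or_odd_zmod_four (d w) with hdw | hdw
    · refine ⟨localComp G v, localComp_mem_lcOrbit G v, d + adjZMod4 G v, w, hw, ?_, ?_⟩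
      · simpa [adjZMod4, hvw] using hdw.add_one
      · rw [← insert_erase hv, power_insert_of_even G (notMem_erase v R) hdv]
    · exact ⟨G, mem_lcOrbit_self G, d, w, hw, hdw, rfl⟩
  · exact ⟨G, mem_lcOrbit_self G, d, v, hv, hdv, rfl⟩

theorem exists_mem_lcOrbit_power_le [Finite V] (G : SimpleGraph V) (d : V → ZMod 4)
    (R : Finset V) : ∃ K ∈ lcOrbit G, power G d R ≤ 2 ^ K.indepNum := by
  classical
  have := Fintype.ofFinite V
  induction R using Finset.strongInduction generalizing G d with
  | H R ih =>
    by_cases hR : G.IsIndepSet R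
    · exact ⟨G, mem_lcOrbit_self G, (power_le G d R).trans
        (pow_le_pow_right₀ one_le_two hR.card_le_indepNum)⟩
    · obtain ⟨K, hK, e, v, hv, he, hpower⟩ := exists_odd_of_not_isIndepSet hR d
      obtain ⟨L, hL, hle⟩ := ih (R.erase v) (erase_ssubset hv) (localComp K v)
        (e + -e v • adjZMod4 K v)
      refine ⟨L, lcOrbit_trans hK (lcOrbit_trans (localComp_mem_lcOrbit K v) hL), ?_⟩
      rwa [hpower, ← insert_erase hv, power_insert_of_odd K (notMem_erase v R) he]

end Power

theorem isGreatest_lam {n : ℕ} (G : SimpleGraph (Fin n)) :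
    IsGreatest {a | ∃ K ∈ lcOrbit G, a = K.indepNum} (lam G) := by
  have hfin : {a | ∃ K ∈ lcOrbit G, a = K.indepNum}.Finite :=
    (Set.finite_range SimpleGraph.indepNum).subset fun _ ⟨K, _, h⟩ => ⟨K, h.symm⟩
  exact ⟨Nat.sSup_mem ⟨_, G, mem_lcOrbit_self G, rfl⟩ hfin.bddAbove,
    fun _ ha => le_csSup hfin.bddAbove ha⟩

theorem isGreatest_powerSpectrum {n : ℕ} (G : SimpleGraph (Fin n)) :
    IsGreatest (powerSpectrum G) (2 ^ lam G) := by
  constructor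
  · obtain ⟨K, hK, hlam⟩ := (isGreatest_lam G).1
    obtain ⟨R, hR⟩ := K.exists_isNIndepSet_indepNum
    rw [← powerSpectrum_eq_of_mem_lcOrbit hK, hlam, ← hR.card_eq]
    exact ⟨0, R, power_zero_of_isIndepSet hR.isIndepSet⟩
  · rintro _ ⟨d, R, rfl⟩
    obtain ⟨K, hK, hle⟩ := exists_mem_lcOrbit_power_le G d R
    exact hle.trans (pow_le_pow_right₀ one_le_two ((isGreatest_lam G).2 ⟨K, hK, rfl⟩))

/-! ### Quadratic Boolean functions as quadratic forms over `ℤ₄` -/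

/-- The embedding `a ↦ 2a` of `ℤ₂` into `ℤ₄`, which turns signs into powers of `i`. -/
def twice : ZMod 2 →+ ZMod 4 where
  toFun a := 2 * a.val
  map_zero' := by decide
  map_add' := by decide

lemma neg_one_pow_val_eq_iPow_twice (a : ZMod 2) : (-1 : ℂ) ^ a.val = iPow (twice a) := by
  rcases (by decide : ∀ b : ZMod 2, b = 0 ∨ b = 1) a with rfl | rfl
  · simp
  · rw [show twice 1 = 2 from rfl, iPow_two, show (1 : ZMod 2).val = 1 from rfl, pow_one]

lemma prod_indVec {n : ℕ} (S T : Finset (Fin n)) :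
    ∏ i ∈ S, indVec T i = if S ⊆ T then 1 else 0 := by
  simp only [indVec, prod_ite_zero, prod_const_one, subset_iff]

lemma apply_indVec {n : ℕ} (f : (Fin n → ZMod 2) → ZMod 2) (T : Finset (Fin n)) :
    f (indVec T) = ∑ S ∈ T.powerset, anfCoeff f S := by
  rw [eq_sum_anfCoeff f]
  simp only [prod_indVec, mul_ite, mul_one, mul_zero, ← sum_filter]
  exact sum_congr (by ext; simp) fun _ _ => rfl

lemma sum_powerset_eq_add_sum_singleton {α M : Type*} [AddCommMonoid M] (g : Finset α → M)
    (T : Finset α) (hg : ∀ S ⊆ T, 1 < #S → g S = 0) :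
    ∑ S ∈ T.powerset, g S = g ∅ + ∑ j ∈ T, g {j} := by
  classical
  induction T using Finset.induction_on with
  | empty => simp
  | insert u T hu ih =>
    have hsingle : ∑ S ∈ T.powerset, g (insert u S) = g {u} := by
      refine sum_eq_single_of_mem ∅ (empty_mem_powerset T) fun S hS hne => ?_
      rw [mem_powerset] at hS
      refine hg _ (insert_subset_insert u hS) ?_
      rw [card_insert_of_notMem fun h => hu (hS h)]
      have := card_pos.2 (nonempty_iff_ne_empty.2 hne)
      lia
    rw [sum_powerset_insert hu, ih fun S hS => hg S (hS.trans (subset_insert u T)), hsingle,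
      sum_insert hu, add_assoc, add_comm (g {u})]

lemma sum_sdiff_eq_sum_powerset {α M : Type*} [Fintype α] [DecidableEq α] [AddCommMonoid M]
    {R F : Finset α} (h : Disjoint R F) (g : Finset α → M) :
    ∑ T with T \ R = F, g T = ∑ T ∈ R.powerset, g (T ∪ F) := by
  refine sum_bij' (fun T _ => T ∩ R) (fun T _ => T ∪ F) ?_ ?_ ?_ ?_ ?_
  · exact fun T _ => mem_powerset.2 inter_subset_right
  · intro T hT
    rw [mem_filter_univ, union_sdiff_distrib, sdiff_eq_empty_iff_subset.2 (mem_powerset.1 hT),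
      sdiff_eq_self_of_disjoint h.symm, empty_union]
  · intro T hT
    rw [← (mem_filter_univ T).1 hT, union_comm, sdiff_union_inter]
  · intro T hT
    rw [union_inter_distrib_right, inter_eq_left.2 (mem_powerset.1 hT),
      disjoint_iff_inter_eq_empty.1 h.symm, union_empty]
  · intro T hT
    rw [← (mem_filter_univ T).1 hT, union_comm, sdiff_union_inter]

namespace IsQuadratic

variable {n : ℕ} {f : (Fin n → ZMod 2) → ZMod 2}

lemma apply_indVec_insert (hf : IsQuadratic f) {v : Fin n} {T : Finset (Fin n)} (hv : v ∉ T) :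
    f (indVec (insert v T)) =
      f (indVec T) + (anfCoeff f {v} + ∑ j ∈ T, anfCoeff f {v, j}) := by
  rw [apply_indVec f, apply_indVec f, sum_powerset_insert hv,
    sum_powerset_eq_add_sum_singleton fun S => anfCoeff f (insert v S)]
  · rfl
  · intro S hS hcard
    refine hf _ ?_
    rw [card_insert_of_notMem fun h => hv (hS h)]
    lia

end IsQuadratic

lemma twice_anfCoeff_pair {n : ℕ} (f : (Fin n → ZMod 2) → ZMod 2) {i j : Fin n} (hij : i ≠ j) :
    twice (anfCoeff f {i, j}) = 2 * adjZMod4 (graphOf f) i j := by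
  have hadj : (graphOf f).Adj i j ↔ anfCoeff f {i, j} = 1 := by
    rw [← (by decide : ∀ a : ZMod 2, a ≠ 0 ↔ a = 1)]
    exact and_iff_right hij
  by_cases h : anfCoeff f {i, j} = 1
  · rw [h, adjZMod4, if_pos (hadj.2 h)]
    decide
  · rw [adjZMod4, if_neg (mt hadj.1 h), (by decide : ∀ a : ZMod 2, a ≠ 1 → a = 0) _ h, map_zero,
      mul_zero]

theorem IsQuadratic.twice_apply_indVec {n : ℕ} {f : (Fin n → ZMod 2) → ZMod 2}
    (hf : IsQuadratic f) (T : Finset (Fin n)) :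
    twice (f (indVec T)) =
      twice (f (indVec ∅)) + graphForm (graphOf f) (fun i => twice (anfCoeff f {i})) T := by
  induction T using Finset.induction_on with
  | empty => simp [graphForm]
  | insert v T hv ih =>
    have hpairs : ∑ j ∈ T, twice (anfCoeff f {v, j}) = 2 * ∑ j ∈ T, adjZMod4 (graphOf f) v j := by
      rw [mul_sum]
      exact sum_congr rfl fun j hj =>
        twice_anfCoeff_pair f (ne_of_mem_of_not_mem hj hv).symm
    rw [hf.apply_indVec_insert hv, map_add, map_add, map_sum, hpairs, ih, graphForm_insert _ _ hv]
    ring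

/-! ### The entries of the `{I, H, N}` transforms -/

lemma indVec_bijective (n : ℕ) :
    Function.Bijective (indVec : Finset (Fin n) → Fin n → ZMod 2) := by
  refine ⟨fun S T h => ?_, fun x => ⟨({i | x i = 1} : Finset (Fin n)), ?_⟩⟩
  · ext i
    have hi := congrFun h i
    by_cases hS : i ∈ S <;> by_cases hT : i ∈ T <;> simp_all [indVec]
  · ext i
    simpa [indVec] using (by decide : ∀ a : ZMod 2, (if a = 1 then 1 else 0) = a) (x i)

/-- The exponent of `i` in the second column and row `k` of the Hadamard (`u = 1`) or negahadamard
(`u = 2`) matrix. -/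
def transExponent (u : Fin 3) (k : ZMod 2) : ZMod 4 :=
  (if u = 2 then 1 else 0) + twice k

lemma exists_transExponent_eq (c : ZMod 4) : ∃ u ≠ 0, ∃ k, transExponent u k = c := by
  revert c
  decide

lemma transIHN_zero (k x : ZMod 2) : transIHN 0 k x = if k = x then 1 else 0 := by
  simp [transIHN, Matrix.one_apply]

lemma transIHN_of_ne_zero {u : Fin 3} (hu : u ≠ 0) (k x : ZMod 2) :
    transIHN u k x =
      ((Real.sqrt 2 : ℝ) : ℂ)⁻¹ * if x = 1 then iPow (transExponent u k) else 1 := by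
  have hexp : transExponent 1 0 = 0 ∧ transExponent 1 1 = 2 ∧ transExponent 2 0 = 1 ∧
      transExponent 2 1 = 3 := by decide
  have hbit : ∀ a : ZMod 2, a = 0 ∨ a = 1 := by decide
  have hcases : u = 1 ∨ u = 2 := by
    revert u
    decide
  rcases hcases with rfl | rfl <;> rcases hbit k with rfl | rfl <;>
    rcases hbit x with rfl | rfl <;>
    simp only [hexp, iPow_one, iPow_two, iPow_three, AddChar.map_zero_eq_one, zero_ne_one, if_true,
      if_false] <;>
    rfl

/-- The positions at which the transform is `H` or `N`. -/
def transSupport {n : ℕ} (u : Fin n → Fin 3) : Finset (Fin n) := {i | u i ≠ 0}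

/-- The positions at which the transform is `I` and the output index `k` is one. Only the inputs
with these ones outside `transSupport u` contribute to the output at `k`. -/
def fixedOnes {n : ℕ} (u : Fin n → Fin 3) (k : Fin n → ZMod 2) : Finset (Fin n) :=
  {i | u i = 0 ∧ k i = 1}

section Transform

variable {n : ℕ} (u : Fin n → Fin 3) (k : Fin n → ZMod 2)

lemma disjoint_transSupport_fixedOnes : Disjoint (transSupport u) (fixedOnes u k) :=
  disjoint_filter.2 fun _ _ hi hi' => hi hi'.1

/-- A vanishing factor of the product is a coordinate at which `I` meets different input and output
values. -/
lemma prod_transIHN_indVec (T : Finset (Fin n)) :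
    ∏ i, transIHN (u i) (k i) (indVec T i) =
      if T \ transSupport u = fixedOnes u k then
        ((Real.sqrt 2 : ℝ) : ℂ)⁻¹ ^ #(transSupport u) *
          iPow (∑ i ∈ T ∩ transSupport u, transExponent (u i) (k i))
      else 0 := by
  have hiff : T \ transSupport u = fixedOnes u k ↔ ∀ i, u i = 0 → k i = indVec T i := by
    have hbit : ∀ a : ZMod 2, a = 0 ∨ a = 1 := by decide
    rw [Finset.ext_iff]
    refine forall_congr' fun i => ?_
    by_cases hu : u i = 0 <;> by_cases hT : i ∈ T <;> rcases hbit (k i) with hk | hk <;>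
      simp [transSupport, fixedOnes, indVec, hu, hT, hk]
  have hentry (h : ∀ i, u i = 0 → k i = indVec T i) (i : Fin n) :
      transIHN (u i) (k i) (indVec T i) =
        (if i ∈ transSupport u then ((Real.sqrt 2 : ℝ) : ℂ)⁻¹ else 1) *
          if i ∈ T ∩ transSupport u then iPow (transExponent (u i) (k i)) else 1 := by
    by_cases hi : u i = 0
    · rw [hi, transIHN_zero, if_pos (h i hi)]
      simp [transSupport, hi]
    · rw [transIHN_of_ne_zero hi]
      simp [transSupport, hi, indVec]
  simp only [hiff]
  split_ifs with h
  · rw [prod_congr rfl fun i _ => hentry h i, prod_mul_distrib, prod_ite_mem, prod_ite_mem,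
      univ_inter, univ_inter, prod_const, addChar_sum]
  · push Not at h
    obtain ⟨i, hi, hne⟩ := h
    exact prod_eq_zero (mem_univ i) (by rw [hi, transIHN_zero, if_neg hne])

theorem tensor_transIHN_mulVec (s : (Fin n → ZMod 2) → ℂ) :
    (tensor fun i => transIHN (u i)).mulVec s k =
      ((Real.sqrt 2 : ℝ) : ℂ)⁻¹ ^ #(transSupport u) * ∑ T ∈ (transSupport u).powerset,
        iPow (∑ i ∈ T, transExponent (u i) (k i)) * s (indVec (T ∪ fixedOnes u k)) := by
  have hdisj := disjoint_transSupport_fixedOnes u k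
  calc (tensor fun i => transIHN (u i)).mulVec s k
      = ∑ T : Finset (Fin n), (∏ i, transIHN (u i) (k i) (indVec T i)) * s (indVec T) :=
        ((indVec_bijective n).sum_comp
          fun x => (∏ i, transIHN (u i) (k i) (x i)) * s x).symm
    _ = ∑ T with T \ transSupport u = fixedOnes u k,
          ((Real.sqrt 2 : ℝ) : ℂ)⁻¹ ^ #(transSupport u) *
            iPow (∑ i ∈ T ∩ transSupport u, transExponent (u i) (k i)) * s (indVec T) := by
        simp only [prod_transIHN_indVec, ite_mul, zero_mul, sum_filter]
    _ = _ := by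
        rw [sum_sdiff_eq_sum_powerset hdisj, mul_sum]
        refine sum_congr rfl fun T hT => ?_
        rw [union_inter_distrib_right, inter_eq_left.2 (mem_powerset.1 hT),
          disjoint_iff_inter_eq_empty.1 hdisj.symm, union_empty, mul_assoc]

end Transform

/-- The diagonal entries of the form over `ℤ₄` whose exponential sum is the output at `k` of the
transform `u` of `stateVec f`: the linear coefficients of `f`, the edges to the coordinates that `I`
fixes to one, and the exponents of the transform. -/
noncomputable def transDiag {n : ℕ} (f : (Fin n → ZMod 2) → ZMod 2) (u : Fin n → Fin 3)
    (k : Fin n → ZMod 2) (i : Fin n) : ZMod 4 :=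
  twice (anfCoeff f {i}) + 2 * ∑ j ∈ fixedOnes u k, adjZMod4 (graphOf f) i j +
    transExponent (u i) (k i)

theorem IsQuadratic.exists_tensor_mulVec_stateVec_eq {n : ℕ} {f : (Fin n → ZMod 2) → ZMod 2}
    (hf : IsQuadratic f) (u : Fin n → Fin 3) (k : Fin n → ZMod 2) :
    ∃ c : ZMod 4, (tensor fun i => transIHN (u i)).mulVec (stateVec f) k =
      ((Real.sqrt 2 : ℝ) : ℂ)⁻¹ ^ #(transSupport u) * (((Real.sqrt 2 : ℝ) : ℂ) ^ n)⁻¹ * iPow c *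
        expSum (graphOf f) (transDiag f u k) (transSupport u) := by
  let lin : Fin n → ZMod 4 := fun i => twice (anfCoeff f {i})
  let c := twice (f (indVec ∅)) + graphForm (graphOf f) lin (fixedOnes u k)
  have hexponent (T) (hT : T ∈ (transSupport u).powerset) :
      ∑ i ∈ T, transExponent (u i) (k i) + twice (f (indVec (T ∪ fixedOnes u k))) =
        c + graphForm (graphOf f) (transDiag f u k) T := by
    have hdiag : transDiag f u k =
        lin + (fun i => 2 * ∑ j ∈ fixedOnes u k, adjZMod4 (graphOf f) i j) +
          fun i => transExponent (u i) (k i) := rfl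
    rw [hf.twice_apply_indVec, graphForm_union _ _
      ((disjoint_transSupport_fixedOnes u k).mono_left (mem_powerset.1 hT)), hdiag]
    simp only [graphForm_add, c, lin]
    ring
  refine ⟨c, ?_⟩
  rw [tensor_transIHN_mulVec, expSum, mul_sum, mul_sum]
  refine sum_congr rfl fun T hT => ?_
  rw [stateVec, neg_one_pow_val_eq_iPow_twice, mul_assoc _ (iPow c), ← iPow.map_add_eq_mul,
    ← hexponent T hT, iPow.map_add_eq_mul]
  ring

theorem IsQuadratic.normSq_tensor_mulVec_stateVec {n : ℕ} {f : (Fin n → ZMod 2) → ZMod 2}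
    (hf : IsQuadratic f) (u : Fin n → Fin 3) (k : Fin n → ZMod 2) :
    2 ^ n * ‖(tensor fun i => transIHN (u i)).mulVec (stateVec f) k‖ ^ 2 =
      power (graphOf f) (transDiag f u k) (transSupport u) := by
  obtain ⟨c, hc⟩ := hf.exists_tensor_mulVec_stateVec_eq u k
  have normSq_sqrt_two_pow (m : ℕ) : (‖((Real.sqrt 2 : ℝ) : ℂ)‖ ^ m) ^ 2 = 2 ^ m := by
    rw [← pow_mul, mul_comm, pow_mul, Complex.norm_real, Real.norm_eq_abs, sq_abs,
      Real.sq_sqrt zero_le_two]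
  rw [hc, power]
  simp only [norm_mul, norm_pow, norm_inv, AddChar.norm_apply, mul_one, mul_pow, inv_pow,
    normSq_sqrt_two_pow]
  field_simp

theorem exists_power_transDiag_eq {n : ℕ} (f : (Fin n → ZMod 2) → ZMod 2) (d : Fin n → ZMod 4)
    (R : Finset (Fin n)) :
    ∃ u k, power (graphOf f) (transDiag f u k) (transSupport u) = power (graphOf f) d R := by
  choose u' hu' k' hexp using fun i => exists_transExponent_eq (d i - twice (anfCoeff f {i}))
  let u : Fin n → Fin 3 := fun i => if i ∈ R then u' i else 0
  let k : Fin n → ZMod 2 := fun i => if i ∈ R then k' i else 0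
  have hsupp : transSupport u = R := by
    ext i
    simp [transSupport, u, hu']
  have hfixed : fixedOnes u k = ∅ := by
    ext i
    by_cases hi : i ∈ R <;> simp [fixedOnes, u, k, hi, hu']
  refine ⟨u, k, ?_⟩
  rw [hsupp]
  refine power_congr _ fun i hi => ?_
  rw [transDiag, hfixed, sum_empty, mul_zero, add_zero]
  simp only [u, k, if_pos hi, hexp, add_sub_cancel]

theorem IsQuadratic.isGreatest_parIHN {n : ℕ} {f : (Fin n → ZMod 2) → ZMod 2}
    (hf : IsQuadratic f) : IsGreatest (powerSpectrum (graphOf f)) (parIHN f) := by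
  let p (uk : (Fin n → Fin 3) × (Fin n → ZMod 2)) : ℝ :=
    ‖(tensor fun i => transIHN (uk.1 i)).mulVec (stateVec f) uk.2‖ ^ 2
  have hpar : parIHN f = 2 ^ n * univ.sup' univ_nonempty p := rfl
  rw [hpar]
  constructor
  · obtain ⟨⟨u, k⟩, -, hmax⟩ := exists_mem_eq_sup' univ_nonempty p
    rw [hmax]
    exact ⟨_, _, (hf.normSq_tensor_mulVec_stateVec u k).symm⟩
  · rintro _ ⟨d, R, rfl⟩
    obtain ⟨u, k, hpower⟩ := exists_power_transDiag_eq f d R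
    rw [← hpower, ← hf.normSq_tensor_mulVec_stateVec]
    exact mul_le_mul_of_nonneg_left (le_sup' p (mem_univ (u, k))) (by positivity)

end BoolPAR

theorem mainTheorem1 {n : ℕ} (G : SimpleGraph (Fin n)) (f : (Fin n → ZMod 2) → ZMod 2)
    (hf : BoolPAR.IsQuadratic f) (hG : BoolPAR.graphOf f ∈ BoolPAR.lcOrbit G) :
    BoolPAR.parIHN f = 2 ^ BoolPAR.lam G := by
  have hmax := hf.isGreatest_parIHN
  rw [BoolPAR.powerSpectrum_eq_of_mem_lcOrbit hG] at hmax
  exact hmax.unique (BoolPAR.isGreatest_powerSpectrum G)
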